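/- Let $|\alpha_{00}\rangle=|0\rangle$, $|\alpha_{11}\rangle=|1\rangle$, $|\alpha_{01}\rangle=|+\rangle=(|0\rangle+|1\rangle)/\sqrt2$, $|\alpha_{10}\rangle=|-\rangle=(|0\rangle-|1\rangle)/\sqrt2$. For integers $n\ge 1$ and $0\le n'\le n$, let $E:\{0,1\}^{n'}\to\{00,01,10,11\}^n$ be a random map whose values $E(v)$ are independent and uniformly distributed, and put $|E(v)\rangle=\bigotimes_{a=1}^n|\alpha_{E(v)_a}\rangle$. A 1-pass LOCC strategy with 2-outcome measurements on $n$ isolated qubits has $n$ steps. At step $a$, depending on the previous outcomes $z_{<a}=(z_1,\dots,z_{a-1})$, it chooses a qubit $Q_a(z_{<a})$ that has not been measured before and a two-element POVM $\{M_a(z_{<a},\zeta)\}_{\zeta}$ on $\mathbb C^2$ (elements positive semidefinite, with sum $I$, possibly zero), and it measures that qubit, with outcome $z_a$. Thus on an $n$-qubit state $|\psi\rangle$ it outputs $z=(z_1,\dots,z_n)$ with probability $\langle\psi|M(z)|\psi\rangle$, where $M(z)=\bigotimes_{a=1}^n M_a(z_{\le a})$ and the factor $M_a(z_{\le a})=M_a(z_{<a},z_a)$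 acts on qubit $Q_a(z_{<a})$. Let $U$ be uniform on $\{0,1\}^{n'}$, and let $Z$ be the output of the strategy on $|E(U)\rangle$. For fixed $E$, let $I(Z;U)=H(Z)-H(Z|U)$ be the mutual information in bits. **Theorem.** There is an absolute constant $C_2$, and for every integer $c\ge 0$ there is a constant $C_1=C_1(c)$, such that for all integers $n\ge1$ and $n'\ge 0$ with $n-c\le n'\le n$, and all real $t_0>0$ and $u\ge1$, with probability at least $$1-\exp(-2t_0^2)-2\cdot 2^{-u^2}$$ over the choice of $E$, every 1-pass LOCC strategy with 2-outcome measurements satisfies $$I(Z;U)\le 0.54\,n+C_1+t_0\,n'\,2^{-n'/2}+u\,C_2\sqrt{\log n}.$$ -/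

import Mathlib

open scoped BigOperators Matrix ComplexOrder

noncomputable section

/-! ## Entropy and mutual information (in bits) of finite random variables -/

/-- Shannon entropy `H(X) = -∑ x, Pr[X = x] lg Pr[X = x]` of a distribution `p` on a finite set
(with `0 lg 0 = 0`). -/
def shannonEntropy {α : Type*} [Fintype α] (p : α → ℝ) : ℝ :=
  -∑ x, p x * Real.logb 2 (p x)

/-- First marginal of a joint distribution. -/
def marginalFst {α β : Type*} [Fintype β] (P : α × β → ℝ) : α → ℝ :=
  fun x => ∑ y, P (x, y)

/-- Second marginal of a joint distribution. -/
def marginalSnd {α β : Type*} [Fintype α] (P : α × β → ℝ) : β → ℝ :=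
  fun y => ∑ x, P (x, y)

/-- Conditional entropy `H(X|Y) = ∑ y, Pr[Y = y] H(X | Y = y)` for the joint distribution `P` of
`(X, Y)`. -/
def condEntropy {α β : Type*} [Fintype α] [Fintype β] (P : α × β → ℝ) : ℝ :=
  ∑ y, marginalSnd P y * shannonEntropy (fun x => P (x, y) / marginalSnd P y)

/-- Mutual information `I(X;Y) = H(X) - H(X|Y)` for the joint distribution `P` of `(X, Y)`. -/
def mutualInfo {α β : Type*} [Fintype α] [Fintype β] (P : α × β → ℝ) : ℝ :=
  shannonEntropy (marginalFst P) - condEntropy P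

/-! ## Isolated qubits and 1-pass LOCC strategies -/

/-- The first `a` entries `z_{<a}` of an outcome string `z`. -/
def history {n q : ℕ} (z : Fin n → Fin q) (a : Fin n) : Fin (a : ℕ) → Fin q :=
  fun b => z (Fin.castLE a.isLt.le b)

/-- A 1-pass LOCC strategy on `n` isolated qubits using (at most) `q`-outcome measurements.
At step `a`, given the outcomes of the previous steps, it chooses a qubit that has not been measured
yet and a POVM on that qubit. POVM elements may vanish, so measurements with fewer than `q` outcomes
are included. -/
structure OnePassLOCC (n q : ℕ) where
  /-- the qubit measured at step `a`, given the previous outcomes -/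
  qubit : (a : Fin n) → (Fin (a : ℕ) → Fin q) → Fin n
  /-- the POVM elements of the measurement made at step `a`, given the previous outcomes -/
  povm : (a : Fin n) → (Fin (a : ℕ) → Fin q) → Fin q → Matrix (Fin 2) (Fin 2) ℂ
  /-- no qubit is measured twice -/
  qubit_injective : ∀ z : Fin n → Fin q, Function.Injective fun a => qubit a (history z a)
  /-- POVM elements are positive semidefinite -/
  povm_posSemidef : ∀ a h ζ, (povm a h ζ).PosSemidef
  /-- the POVM elements of each measurement sum to the identity -/
  povm_sum : ∀ a h, ∑ ζ, povm a h ζ = 1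

/-- The element `M(z) = ⨂ₐ M_a(z_{≤a})` of the `n`-qubit POVM implemented by a strategy, where
`M_a(z_{≤a})` acts on the qubit `Q_a(z_{<a})`. It is a matrix in the computational basis `{0,1}ⁿ`. -/
def OnePassLOCC.element {n q : ℕ} (S : OnePassLOCC n q) (z : Fin n → Fin q) :
    Matrix (Fin n → Fin 2) (Fin n → Fin 2) ℂ :=
  Matrix.of fun x y =>
    ∏ a, S.povm a (history z a) (z a)
      (x (S.qubit a (history z a))) (y (S.qubit a (history z a)))

/-- The probability `⟨ψ| M(z) |ψ⟩` of observing `z` when the strategy is applied to the pure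
`n`-qubit state `ψ`. -/
def OnePassLOCC.outcomeProb {n q : ℕ} (S : OnePassLOCC n q) (ψ : (Fin n → Fin 2) → ℂ)
    (z : Fin n → Fin q) : ℝ :=
  (star ψ ⬝ᵥ (S.element z *ᵥ ψ)).re

/-- The joint distribution of `(Z, U)` in the state discrimination game: `U` is uniform on the finite
set `𝒰` of messages and `Z` is the output of the strategy on the state `ψ U`. -/
def OnePassLOCC.jointDist {n q : ℕ} (S : OnePassLOCC n q) {𝒰 : Type*} [Fintype 𝒰]
    (ψ : 𝒰 → (Fin n → Fin 2) → ℂ) : (Fin n → Fin q) × 𝒰 → ℝ :=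
  fun p => (Fintype.card 𝒰 : ℝ)⁻¹ * S.outcomeProb (ψ p.2) p.1

/-! ## The random data-hiding states -/

/-- The single-qubit states `α₀₀ = |0⟩`, `α₁₁ = |1⟩`, `α₀₁ = |+⟩`, `α₁₀ = |-⟩`. -/
def conjugateState : Bool × Bool → Fin 2 → ℂ
  | (false, false) => ![1, 0]
  | (true, true) => ![0, 1]
  | (false, true) => ![((1 / √2 : ℝ) : ℂ), ((1 / √2 : ℝ) : ℂ)]
  | (true, false) => ![((1 / √2 : ℝ) : ℂ), -((1 / √2 : ℝ) : ℂ)]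

/-- The product state `⨂ₐ |α_{wₐ}⟩` of a label string `w ∈ {00,01,10,11}ⁿ`. -/
def productState {n : ℕ} (w : Fin n → Bool × Bool) : (Fin n → Fin 2) → ℂ :=
  fun x => ∏ a, conjugateState (w a) (x a)

/-- The law of the random map `E : {0,1}^m → {00,01,10,11}^n`: the values `E(u)` are independent and
uniformly distributed in `{00,01,10,11}^n`. -/
def encodingLaw (m n : ℕ) : MeasureTheory.Measure ((Fin m → Bool) → (Fin n → Bool × Bool)) :=
  MeasureTheory.Measure.pi fun _ => ProbabilityTheory.uniformOn Set.univ

/-- The information `I(Z;U)` that the strategy `S` extracts about a uniformly random message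
`U ∈ {0,1}^m` from the data-hiding state `|E(U)⟩`. -/
def extractedInfo {m n q : ℕ} (E : (Fin m → Bool) → (Fin n → Bool × Bool))
    (S : OnePassLOCC n q) : ℝ :=
  mutualInfo (S.jointDist fun v => productState (E v))

end

/-! For a fixed strategy, `I(Z;U)` is at most the average over `v` of the divergence of the outcome
law on `|E(v)⟩` from any fixed reference law. The reference is the law on the maximally mixed state.
Each divergence is at most `3 lg` of a moment of order `4/3` of the likelihood ratio
(`divergence_le_renyi`). Since likelihood and reference are products over the steps, the mean of
this moment over a random codeword factorizes. Each qubit contributes at most `1.13`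
(`sum_bornProb_rpow_le`), by positivity of the POVM element, and `1.13 < 2^(0.54/3)`.

The codewords are independent, so Markov's inequality for the product of the `2^n'` moments makes a
fixed strategy exceed `0.54 n` with probability at most `(rate^n)^(2^n')`, where `rate < 1`.

To reach all strategies at once, outcome probabilities are rounded to a grid of fixed mesh, and the
likelihoods are enlarged by the mesh so that one moment serves a whole class. There are at most `(n
* 10001^8)^(2^n)` classes. As `2^n ≤ 2^c * 2^n'`, the union bound is the `2^n'`-th power of a
quantity tending to `0`. Small `n` and large `u` are covered by `I(Z;U) ≤ n`. -/

/-! ## Information inequalities -/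

/-- Gibbs' inequality, in terms of `logb 2`. -/
lemma shannonEntropy_le_cross {α : Type*} [Fintype α] (r q : α → ℝ) (hr : ∀ z, 0 ≤ r z)
    (hr1 : ∑ z, r z = 1) (hq : ∀ z, 0 < q z) (hq1 : ∑ z, q z ≤ 1) :
    shannonEntropy r ≤ -∑ z, r z * Real.logb 2 (q z) := by
  have h2 : 0 < Real.log 2 := Real.log_pos (by norm_num)
  have key : ∀ z, r z * Real.log (q z) - r z * Real.log (r z) ≤ q z - r z := by
    intro z
    rcases (hr z).eq_or_lt with h | h
    · simp [← h, (hq z).le]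
    · have := Real.log_le_sub_one_of_pos (div_pos (hq z) h)
      rw [Real.log_div (hq z).ne' h.ne'] at this
      have h' := mul_le_mul_of_nonneg_left this h.le
      have : r z * (q z / r z - 1) = q z - r z := by field_simp
      linarith
  have hs := Finset.sum_le_sum fun z (_ : z ∈ Finset.univ) => key z
  simp only [Finset.sum_sub_distrib] at hs
  have hs' : ∑ z, r z * Real.log (q z) ≤ ∑ z, r z * Real.log (r z) := by linarith
  unfold shannonEntropy Real.logb
  simp only [← mul_div_assoc, ← Finset.sum_div]
  exact neg_le_neg (div_le_div_of_nonneg_right hs' h2.le)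

/-- The mutual information is at most the average divergence of the conditional laws from any
fixed reference law. -/
lemma mutualInfo_le_avg_divergence {α β : Type*} [Fintype α] [Fintype β] [Nonempty β]
    (p : β → α → ℝ) (hp : ∀ v z, 0 ≤ p v z) (hp1 : ∀ v, ∑ z, p v z = 1)
    (q : α → ℝ) (hq : ∀ z, 0 < q z) (hq1 : ∑ z, q z ≤ 1) :
    mutualInfo (fun x : α × β => (Fintype.card β : ℝ)⁻¹ * p x.2 x.1) ≤
      (Fintype.card β : ℝ)⁻¹ * ∑ v, ∑ z, p v z * Real.logb 2 (p v z / q z) := by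
  have hN : (0 : ℝ) < Fintype.card β := by exact_mod_cast Fintype.card_pos
  set N : ℝ := (Fintype.card β : ℝ)
  have hsnd : ∀ v, marginalSnd (fun x : α × β => N⁻¹ * p x.2 x.1) v = N⁻¹ := by
    intro v
    simp [marginalSnd, ← Finset.mul_sum, hp1]
  have hcond : condEntropy (fun x : α × β => N⁻¹ * p x.2 x.1) =
      -(N⁻¹ * ∑ v, ∑ z, p v z * Real.logb 2 (p v z)) := by
    unfold condEntropy shannonEntropy
    simp only [hsnd]
    have : ∀ v z, N⁻¹ * p v z / N⁻¹ = p v z := fun v z => by field_simp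
    simp [this, ← Finset.mul_sum]
  have hfst : shannonEntropy (marginalFst fun x : α × β => N⁻¹ * p x.2 x.1) ≤
      -(N⁻¹ * ∑ v, ∑ z, p v z * Real.logb 2 (q z)) := by
    refine (shannonEntropy_le_cross (marginalFst fun x : α × β => N⁻¹ * p x.2 x.1) q ?_ ?_
      hq hq1).trans (le_of_eq ?_)
    · intro z
      exact Finset.sum_nonneg fun v _ => mul_nonneg (inv_nonneg.2 hN.le) (hp v z)
    · unfold marginalFst
      rw [Finset.sum_comm]
      simp only [← Finset.mul_sum, hp1]
      simp [N]
    · unfold marginalFst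
      simp only [Finset.mul_sum, Finset.sum_mul]
      rw [Finset.sum_comm]
      simp only [mul_assoc]
  have hsplit : ∀ v z, p v z * Real.logb 2 (p v z / q z) =
      p v z * Real.logb 2 (p v z) - p v z * Real.logb 2 (q z) := by
    intro v z
    rcases (hp v z).eq_or_lt with h | h
    · simp [← h]
    · rw [Real.logb_div h.ne' (hq z).ne', mul_sub]
  unfold mutualInfo
  simp only [hsplit, Finset.sum_sub_distrib, mul_sub]
  linarith

/-- A divergence is bounded by the corresponding Rényi divergence of order `4/3`. -/
lemma divergence_le_renyi {α : Type*} [Fintype α] (p q : α → ℝ) (hp : ∀ z, 0 ≤ p z)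
    (hp1 : ∑ z, p z = 1) (hq : ∀ z, 0 < q z) :
    0 < ∑ z, p z * (p z / q z) ^ (1 / 3 : ℝ) ∧
    ∑ z, p z * Real.logb 2 (p z / q z) ≤
      3 * Real.logb 2 (∑ z, p z * (p z / q z) ^ (1 / 3 : ℝ)) := by
  have h2 : 0 < Real.log 2 := Real.log_pos (by norm_num)
  set Y := ∑ z, p z * (p z / q z) ^ (1 / 3 : ℝ) with hY
  have hYpos : 0 < Y := by
    obtain ⟨z, -, hz⟩ : ∃ z ∈ Finset.univ, 0 < p z := by
      by_contra! h
      have := Finset.sum_nonpos h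
      linarith
    refine Finset.sum_pos' (fun z _ => mul_nonneg (hp z)
      (Real.rpow_nonneg (div_nonneg (hp z) (hq z).le) _)) ⟨z, Finset.mem_univ _, ?_⟩
    exact mul_pos hz (Real.rpow_pos_of_pos (div_pos hz (hq z)) _)
  refine ⟨hYpos, ?_⟩
  -- Jensen's inequality for the logarithm, obtained from `log x ≤ x - 1` at `x = (p z / q z)^(1/3)
  -- / Y`.
  have key : ∀ z, p z * Real.log (p z / q z) / 3 - p z * Real.log Y ≤
      p z * (p z / q z) ^ (1 / 3 : ℝ) / Y - p z := by
    intro z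
    rcases (hp z).eq_or_lt with h | h
    · simp [← h]
    · have hx := div_pos h (hq z)
      have hx' := Real.rpow_pos_of_pos hx (1 / 3)
      have := Real.log_le_sub_one_of_pos (div_pos hx' hYpos)
      rw [Real.log_div hx'.ne' hYpos.ne', Real.log_rpow hx] at this
      have := mul_le_mul_of_nonneg_left this h.le
      calc _ = p z * (1 / 3 * Real.log (p z / q z) - Real.log Y) := by ring
        _ ≤ _ := this
        _ = _ := by ring
  have hs := Finset.sum_le_sum fun z (_ : z ∈ Finset.univ) => key z
  simp only [Finset.sum_sub_distrib, ← Finset.sum_div, ← Finset.sum_mul, hp1, ← hY,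
    div_self hYpos.ne', sub_self] at hs
  unfold Real.logb
  simp only [← mul_div_assoc, ← Finset.sum_div]
  rw [div_le_div_iff_of_pos_right h2]
  linarith

/-! ## Sums over outcome strings -/

/-- Factor `a` sees only `z_{≤a}`, so the last outcome can be summed first. Iterating this evaluates
sums over adaptive strategies one step at a time. -/
lemma sum_prod_history_succ {q n : ℕ}
    (F : (a : Fin (n + 1)) → (Fin (a : ℕ) → Fin q) → Fin q → ℝ) :
    ∑ z, ∏ a, F a (history z a) (z a) =
      ∑ z : Fin n → Fin q, (∏ a : Fin n, F a.castSucc (history z a) (z a)) *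
        ∑ ζ, F (Fin.last n) z ζ := by
  rw [← (Fin.snocEquiv fun _ : Fin (n + 1) => Fin q).sum_comp, Fintype.sum_prod_type,
    Finset.sum_comm]
  refine Finset.sum_congr rfl fun z _ => ?_
  rw [Finset.mul_sum]
  refine Finset.sum_congr rfl fun ζ _ => ?_
  change ∏ a, F a (history (Fin.snoc z ζ : Fin (n + 1) → Fin q) a)
    ((Fin.snoc z ζ : Fin (n + 1) → Fin q) a) = _
  rw [Fin.prod_univ_castSucc]
  congr 1
  · refine Finset.prod_congr rfl fun a _ => ?_
    have : history (Fin.snoc z ζ : Fin (n + 1) → Fin q) a.castSucc = history z a := by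
      funext b
      exact Fin.snoc_castSucc (α := fun _ => Fin q) ζ z (Fin.castLE a.isLt.le b)
    rw [this, Fin.snoc_castSucc]
  · have : history (Fin.snoc z ζ : Fin (n + 1) → Fin q) (Fin.last n) = z := by
      funext b
      exact Fin.snoc_castSucc (α := fun _ => Fin q) ζ z b
    rw [this, Fin.snoc_last]

lemma sum_prod_history_le {q : ℕ} (B : ℝ) (hB : 0 ≤ B) : ∀ {n : ℕ}
    (F : (a : Fin n) → (Fin (a : ℕ) → Fin q) → Fin q → ℝ) (_ : ∀ a h ζ, 0 ≤ F a h ζ)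
    (_ : ∀ a h, ∑ ζ, F a h ζ ≤ B), ∑ z, ∏ a, F a (history z a) (z a) ≤ B ^ n
  | 0, _, _, _ => by simp
  | n + 1, F, h0, h1 => by
    rw [sum_prod_history_succ]
    calc _ ≤ ∑ z : Fin n → Fin q, (∏ a : Fin n, F a.castSucc (history z a) (z a)) * B :=
          Finset.sum_le_sum fun z _ => mul_le_mul_of_nonneg_left (h1 _ _)
            (Finset.prod_nonneg fun a _ => h0 _ _ _)
      _ ≤ B ^ n * B := by
          rw [← Finset.sum_mul]
          exact mul_le_mul_of_nonneg_right (sum_prod_history_le B hB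
            (fun a h ζ => F a.castSucc h ζ) (fun _ _ _ => h0 _ _ _) fun a h => h1 _ _) hB
      _ = B ^ (n + 1) := (pow_succ _ _).symm

lemma sum_prod_history_eq_one {q : ℕ} : ∀ {n : ℕ}
    (F : (a : Fin n) → (Fin (a : ℕ) → Fin q) → Fin q → ℝ)
    (_ : ∀ a h, ∑ ζ, F a h ζ = 1), ∑ z, ∏ a, F a (history z a) (z a) = 1
  | 0, _, _ => by simp
  | n + 1, F, h1 => by
    rw [sum_prod_history_succ]
    simp only [h1, mul_one]
    exact sum_prod_history_eq_one (fun a h ζ => F a.castSucc h ζ) fun a h => h1 _ _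

/-! ## Single-qubit measurements -/

/-- The probability `⟨α_s| M |α_s⟩` of a measurement outcome with POVM element `M`. -/
noncomputable def bornProb (M : Matrix (Fin 2) (Fin 2) ℂ) (s : Bool × Bool) : ℝ :=
  (star (conjugateState s) ⬝ᵥ (M *ᵥ conjugateState s)).re

lemma bornProb_eq (M : Matrix (Fin 2) (Fin 2) ℂ) :
    bornProb M (false, false) = (M 0 0).re ∧ bornProb M (true, true) = (M 1 1).re ∧
    bornProb M (false, true) = ((M 0 0).re + (M 1 1).re + (M 0 1).re + (M 1 0).re) / 2 ∧
    bornProb M (true, false) = ((M 0 0).re + (M 1 1).re - (M 0 1).re - (M 1 0).re) / 2 := by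
  have hs : √2 ^ 2 = (2 : ℝ) := Real.sq_sqrt (by norm_num)
  refine ⟨?_, ?_, ?_, ?_⟩ <;>
    simp [bornProb, conjugateState, dotProduct, Matrix.mulVec, Fin.sum_univ_two] <;>
    ring_nf <;> (try simp only [hs]) <;> ring_nf

lemma bornProb_nonneg {M : Matrix (Fin 2) (Fin 2) ℂ} (hM : M.PosSemidef) (s : Bool × Bool) :
    0 ≤ bornProb M s :=
  (Complex.le_def.1 (hM.dotProduct_mulVec_nonneg (conjugateState s))).1

lemma ofReal_bornProb {M : Matrix (Fin 2) (Fin 2) ℂ} (hM : M.PosSemidef) (s : Bool × Bool) :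
    (bornProb M s : ℂ) = star (conjugateState s) ⬝ᵥ (M *ᵥ conjugateState s) := by
  apply Complex.ext
  · simp [bornProb]
  · simpa using (Complex.le_def.1 (hM.dotProduct_mulVec_nonneg (conjugateState s))).2

/-- The cubic is tangent to `x^(4/3)` at `1` and meets it at `0`. With `x = y^3` the difference is
`y^3 (y-1)^2 / 150` times a quartic that is nonnegative up to `y = 2^(1/3)`. A cubic is used because
its odd terms cancel between opposite states, leaving only the coefficient `13/50`. -/
lemma rpow_four_thirds_le {x : ℝ} (h0 : 0 ≤ x) (h2 : x ≤ 2) :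
    x * x ^ (1 / 3 : ℝ) ≤
      1 + 4 / 3 * (x - 1) + 13 / 50 * (x - 1) ^ 2 - 11 / 150 * (x - 1) ^ 3 := by
  obtain ⟨y, hy, rfl⟩ : ∃ y : ℝ, 0 ≤ y ∧ x = y ^ 3 :=
    ⟨x ^ (1 / 3 : ℝ), Real.rpow_nonneg h0 _, by
      rw [← Real.rpow_natCast, ← Real.rpow_mul h0]; norm_num⟩
  have : (y ^ 3) ^ (1 / 3 : ℝ) = y := by
    rw [← Real.rpow_natCast, ← Real.rpow_mul hy]; norm_num
  rw [this]
  -- `63/50` lies just above the cube root of `2`; the quartic below is still positive there, with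
  -- little to spare.
  have hy' : y ≤ 63 / 50 := by
    by_contra! h
    have := pow_lt_pow_left₀ h (by norm_num) three_ne_zero
    norm_num at this
    linarith
  have h4 : 0 ≤ 89 + 28 * y - 33 * y ^ 2 - 22 * y ^ 3 - 11 * y ^ 4 := by
    nlinarith [mul_le_mul_of_nonneg_left h2 hy]
  have h5 := mul_nonneg (pow_nonneg hy 3) (mul_nonneg (sq_nonneg (y - 1)) h4)
  nlinarith [h5]

/-- For a positive semidefinite `M`, the order-`4/3` moment of the outcome probability on a uniformly
random conjugate state. -/
lemma sum_bornProb_rpow_le {M : Matrix (Fin 2) (Fin 2) ℂ} (hM : M.PosSemidef) {δ : ℝ} (hδ : 0 < δ) :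
    ∑ s, (bornProb M s + δ) * ((bornProb M s + δ) / (M.trace.re / 2 + δ)) ^ (1 / 3 : ℝ) ≤
      4 * (113 / 100 * (M.trace.re / 2 + δ)) := by
  obtain ⟨e1, e2, e3, e4⟩ := bornProb_eq M
  have hA := bornProb_nonneg hM (false, false)
  have hD := bornProb_nonneg hM (true, true)
  have hP := bornProb_nonneg hM (false, true)
  have hQ := bornProb_nonneg hM (true, false)
  have hsym : (M 1 0).re = (M 0 1).re := by
    rw [← hM.1.apply 0 1]; simp
  have hdet : (M 0 1).re ^ 2 ≤ (M 0 0).re * (M 1 1).re := by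
    have h := (Complex.le_def.1 hM.det_nonneg).1
    have i0 : (M 0 0).im = 0 := by
      have := congrArg Complex.im (hM.1.apply 0 0)
      simp at this; linarith
    have hi : (M 1 0).im = -(M 0 1).im := by
      rw [← hM.1.apply 0 1]; simp
    rw [Matrix.det_fin_two] at h
    simp [hsym, hi, i0] at h
    nlinarith [sq_nonneg (M 0 1).im]
  have htr : M.trace.re = (M 0 0).re + (M 1 1).re := by
    simp [Matrix.trace, Fin.sum_univ_two]
  rw [hsym] at e3 e4
  rw [e1] at hA
  rw [e2] at hD
  rw [e3] at hP
  rw [e4] at hQ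
  rw [Fintype.sum_prod_type]
  simp only [Fintype.sum_bool, e1, e2, e3, e4, htr]
  generalize (M 0 0).re = A at *
  generalize (M 1 1).re = D at *
  generalize (M 0 1).re = b at *
  set p := (A + D) / 2 + δ with hp
  have hp0 : 0 < p := by positivity
  have step : ∀ r : ℝ, -1 ≤ r → r ≤ 1 → ∀ m, m = p * (1 + r) →
      m * (m / p) ^ (1 / 3 : ℝ) ≤
        p * (1 + 4 / 3 * r + 13 / 50 * r ^ 2 - 11 / 150 * r ^ 3) := by
    rintro r h1 h2 m rfl
    have h := mul_le_mul_of_nonneg_left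
      (rpow_four_thirds_le (x := 1 + r) (by linarith) (by linarith)) hp0.le
    rw [mul_div_cancel_left₀ _ hp0.ne', mul_assoc]
    simpa using h
  -- `r` and `t` are the Bloch coordinates of `M` along the two bases, relative to `p`. The four
  -- smoothed probabilities are `p (1 ± r)` and `p (1 ± t)`.
  obtain ⟨r, hr⟩ : ∃ r, r * p = (A - D) / 2 := ⟨_, div_mul_cancel₀ _ hp0.ne'⟩
  obtain ⟨t, ht⟩ : ∃ t, t * p = b := ⟨_, div_mul_cancel₀ _ hp0.ne'⟩
  have hle : ∀ x y : ℝ, x * p ≤ y * p → x ≤ y := fun x y h => le_of_mul_le_mul_right h hp0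
  have hr1 : r ≤ 1 := hle _ _ (by linarith)
  have hr2 : -1 ≤ r := hle _ _ (by linarith)
  have ht1 : t ≤ 1 := hle _ _ (by linarith)
  have ht2 : -1 ≤ t := hle _ _ (by linarith)
  -- The determinant condition puts the Bloch vector in the unit disc; `δ` only shortens it.
  have hrt : r ^ 2 + t ^ 2 ≤ 1 := by
    refine le_of_mul_le_mul_right ?_ (mul_pos hp0 hp0)
    have : (r ^ 2 + t ^ 2) * (p * p) = ((A - D) / 2) ^ 2 + b ^ 2 := by rw [← hr, ← ht]; ring
    rw [this, hp]
    nlinarith [mul_nonneg hδ.le hA, mul_nonneg hδ.le hD]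
  have s1 := step r hr2 hr1 (A + δ) (by linarith)
  have s2 := step (-r) (by linarith) (by linarith) (D + δ) (by linarith)
  have s3 := step t ht2 ht1 ((A + D + b + b) / 2 + δ) (by linarith)
  have s4 := step (-t) (by linarith) (by linarith) ((A + D - b - b) / 2 + δ) (by linarith)
  -- Summing the four bounds gives `p (4 + 2 * (13/50) * (r^2 + t^2)) ≤ 4 * 1.13 * p`.
  have := mul_le_mul_of_nonneg_left hrt hp0.le
  nlinarith

/-! ## Outcome laws of a strategy on product states -/

namespace OnePassLOCC

variable {n q : ℕ}

/-- The measured qubits, along a fixed outcome string, as a permutation. -/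
noncomputable def qubitPerm (S : OnePassLOCC n q) (z : Fin n → Fin q) : Equiv.Perm (Fin n) :=
  Equiv.ofBijective _ (Finite.injective_iff_bijective.1 (S.qubit_injective z))

/-- Along a fixed outcome string the measured qubits form a permutation, so after reindexing both
basis sums split qubit by qubit. -/
lemma outcomeProb_productState (S : OnePassLOCC n q) (w : Fin n → Bool × Bool)
    (z : Fin n → Fin q) :
    S.outcomeProb (productState w) z =
      ∏ a, bornProb (S.povm a (history z a) (z a)) (w (S.qubit a (history z a))) := by
  have key : star (productState w) ⬝ᵥ (S.element z *ᵥ productState w) =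
      ∏ a, star (conjugateState (w (S.qubit a (history z a)))) ⬝ᵥ
        (S.povm a (history z a) (z a) *ᵥ conjugateState (w (S.qubit a (history z a)))) := by
    have hperm : ∀ f : Fin n → ℂ, ∏ a, f a = ∏ a, f (S.qubit a (history z a)) :=
      fun f => (Equiv.prod_comp (S.qubitPerm z) f).symm
    have hsum : ∀ f : Fin n → Fin 2 → ℂ, ∑ x : Fin n → Fin 2, ∏ a, f a (x (S.qubit a (history z a)))
        = ∏ a, ∑ i, f a i := by
      intro f
      rw [Finset.prod_univ_sum, Fintype.piFinset_univ]
      exact Fintype.sum_equiv ((S.qubitPerm z).symm.arrowCongr (Equiv.refl _)) _ _ fun x => rfl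
    simp only [dotProduct, Matrix.mulVec, element, Matrix.of_apply, productState, Pi.star_apply]
    have hx : ∀ x : Fin n → Fin 2, star (∏ a, conjugateState (w a) (x a)) *
        ∑ y : Fin n → Fin 2, (∏ a, S.povm a (history z a) (z a) (x (S.qubit a (history z a)))
          (y (S.qubit a (history z a)))) * ∏ a, conjugateState (w a) (y a) =
        ∏ a, star (conjugateState (w (S.qubit a (history z a))) (x (S.qubit a (history z a)))) *
          ∑ j, S.povm a (history z a) (z a) (x (S.qubit a (history z a))) j *
            conjugateState (w (S.qubit a (history z a))) j := by
      intro x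
      rw [Finset.prod_mul_distrib, ← hsum (fun a j => S.povm a (history z a) (z a)
        (x (S.qubit a (history z a))) j * conjugateState (w (S.qubit a (history z a))) j),
        star_prod, hperm (fun a => star (conjugateState (w a) (x a)))]
      congr 1
      refine Finset.sum_congr rfl fun y _ => ?_
      rw [hperm (fun a => conjugateState (w a) (y a)), Finset.prod_mul_distrib]
    simp only [hx]
    exact hsum fun a i => star (conjugateState (w (S.qubit a (history z a))) i) *
          ∑ j, S.povm a (history z a) (z a) i j * conjugateState (w (S.qubit a (history z a))) j
  unfold outcomeProb
  rw [key]
  simp only [← ofReal_bornProb (S.povm_posSemidef _ _ _)]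
  rw [← Complex.ofReal_prod, Complex.ofReal_re]

lemma sum_bornProb (S : OnePassLOCC n q) (a : Fin n) (h : Fin (a : ℕ) → Fin q) (s : Bool × Bool) :
    ∑ ζ, bornProb (S.povm a h ζ) s = 1 := by
  have h1 : ∑ ζ, bornProb (S.povm a h ζ) s = bornProb (∑ ζ, S.povm a h ζ) s := by
    unfold bornProb
    rw [Matrix.sum_mulVec, dotProduct_sum, Complex.re_sum]
  rw [h1, S.povm_sum]
  obtain ⟨e1, e2, e3, e4⟩ := bornProb_eq 1
  rcases s with ⟨_ | _, _ | _⟩ <;> simp [*]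

lemma sum_trace (S : OnePassLOCC n q) (a : Fin n) (h : Fin (a : ℕ) → Fin q) :
    ∑ ζ, (S.povm a h ζ).trace.re = 2 := by
  rw [← Complex.re_sum, ← Matrix.trace_sum, S.povm_sum]
  simp

lemma trace_nonneg (S : OnePassLOCC n q) (a : Fin n) (h : Fin (a : ℕ) → Fin q) (ζ : Fin q) :
    0 ≤ (S.povm a h ζ).trace.re :=
  (Complex.le_def.1 (S.povm_posSemidef a h ζ).trace_nonneg).1

lemma outcomeProb_nonneg (S : OnePassLOCC n q) (w : Fin n → Bool × Bool) (z : Fin n → Fin q) :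
    0 ≤ S.outcomeProb (productState w) z := by
  rw [outcomeProb_productState]
  exact Finset.prod_nonneg fun a _ => bornProb_nonneg (S.povm_posSemidef _ _ _) _

lemma sum_outcomeProb (S : OnePassLOCC n q) (w : Fin n → Bool × Bool) :
    ∑ z, S.outcomeProb (productState w) z = 1 := by
  simp only [outcomeProb_productState]
  exact sum_prod_history_eq_one (fun a h ζ => bornProb (S.povm a h ζ) (w (S.qubit a h)))
    fun a h => S.sum_bornProb a h _

/-! ## Smoothed likelihoods -/

/-- Upper bound, valid for all strategies close to `S`, for the likelihood of `z` on the product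
state labelled by `w`. -/
noncomputable def smoothProb (S : OnePassLOCC n q) (δ : ℝ) (w : Fin n → Bool × Bool)
    (z : Fin n → Fin q) : ℝ :=
  ∏ a, (bornProb (S.povm a (history z a) (z a)) (w (S.qubit a (history z a))) + δ)

/-- The probability weight of `z` on the smoothed maximally mixed state. -/
noncomputable def smoothRef (S : OnePassLOCC n q) (δ : ℝ) (z : Fin n → Fin q) : ℝ :=
  ∏ a, (((S.povm a (history z a) (z a)).trace.re / 2 + δ) / (1 + q * δ))

/-- The moment of order `4/3` of the smoothed likelihood ratio. -/
noncomputable def smoothMoment (S : OnePassLOCC n q) (δ : ℝ) (w : Fin n → Bool × Bool) : ℝ :=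
  ∑ z, S.smoothProb δ w z * (S.smoothProb δ w z / S.smoothRef δ z) ^ (1 / 3 : ℝ)

variable {δ : ℝ}

lemma smoothProb_pos (S : OnePassLOCC n q) (hδ : 0 < δ) (w : Fin n → Bool × Bool)
    (z : Fin n → Fin q) : 0 < S.smoothProb δ w z :=
  Finset.prod_pos fun _ _ => add_pos_of_nonneg_of_pos
    (bornProb_nonneg (S.povm_posSemidef _ _ _) _) hδ

lemma smoothRef_pos (S : OnePassLOCC n q) (hδ : 0 < δ) (z : Fin n → Fin q) :
    0 < S.smoothRef δ z :=
  Finset.prod_pos fun _ _ => div_pos (add_pos_of_nonneg_of_pos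
    (div_nonneg (S.trace_nonneg _ _ _) two_pos.le) hδ) (by positivity)

lemma sum_smoothRef (S : OnePassLOCC n q) (hδ : 0 < δ) : ∑ z, S.smoothRef δ z = 1 := by
  refine sum_prod_history_eq_one
    (fun a h ζ => ((S.povm a h ζ).trace.re / 2 + δ) / (1 + q * δ)) fun a h => ?_
  have : (1 + q * δ) ≠ 0 := by positivity
  rw [← Finset.sum_div, Finset.sum_add_distrib, ← Finset.sum_div, S.sum_trace]
  simp [this]

lemma smoothMoment_nonneg (S : OnePassLOCC n q) (hδ : 0 < δ) (w : Fin n → Bool × Bool) :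
    0 ≤ S.smoothMoment δ w :=
  Finset.sum_nonneg fun z _ => mul_nonneg (S.smoothProb_pos hδ w z).le
    (Real.rpow_nonneg (div_nonneg (S.smoothProb_pos hδ w z).le (S.smoothRef_pos hδ z).le) _)

/-- For fixed `z` every qubit is measured exactly once, so the sum over words splits into
single-qubit sums. One factor `1 + q * δ` comes from normalizing the reference law, the other from
summing the smoothed traces over outcomes. -/
lemma sum_smoothMoment_le (S : OnePassLOCC n q) (hδ : 0 < δ) :
    ∑ w, S.smoothMoment δ w ≤ (4 * (113 / 100 * (1 + q * δ) ^ 2)) ^ n := by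
  set c : ℝ := 1 + q * δ with hc
  have hc1 : 1 ≤ c := le_add_of_nonneg_right (by positivity)
  have hc0 : 0 < c := by linarith
  set f : (a : Fin n) → (Fin (a : ℕ) → Fin q) → Fin q → Bool × Bool → ℝ := fun a h ζ s =>
    (bornProb (S.povm a h ζ) s + δ) *
      ((bornProb (S.povm a h ζ) s + δ) / (((S.povm a h ζ).trace.re / 2 + δ) / c)) ^ (1 / 3 : ℝ)
    with hf
  have hb : ∀ a h ζ s, 0 < bornProb (S.povm a h ζ) s + δ := fun a h ζ s =>
    add_pos_of_nonneg_of_pos (bornProb_nonneg (S.povm_posSemidef _ _ _) _) hδ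
  have ht : ∀ a h ζ, 0 < (S.povm a h ζ).trace.re / 2 + δ := fun a h ζ =>
    add_pos_of_nonneg_of_pos (div_nonneg (S.trace_nonneg _ _ _) two_pos.le) hδ
  have hf0 : ∀ a h ζ s, 0 ≤ f a h ζ s := fun a h ζ s =>
    mul_nonneg (hb a h ζ s).le (Real.rpow_nonneg (div_nonneg (hb a h ζ s).le
      (div_nonneg (ht a h ζ).le hc0.le)) _)
  have h1 : ∀ w z, S.smoothProb δ w z * (S.smoothProb δ w z / S.smoothRef δ z) ^ (1 / 3 : ℝ) =
      ∏ a, f a (history z a) (z a) (w (S.qubit a (history z a))) := by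
    intro w z
    unfold smoothProb smoothRef
    rw [← Finset.prod_div_distrib, ← Real.finsetProd_rpow, ← Finset.prod_mul_distrib]
    intro a _
    exact div_nonneg (hb _ _ _ _).le (div_nonneg (ht _ _ _).le hc0.le)
  have h2 : ∑ w, S.smoothMoment δ w = ∑ z, ∏ a, ∑ s, f a (history z a) (z a) s := by
    unfold smoothMoment
    simp only [h1]
    rw [Finset.sum_comm]
    refine Finset.sum_congr rfl fun z _ => ?_
    rw [Finset.prod_univ_sum, Fintype.piFinset_univ]
    exact Fintype.sum_equiv ((S.qubitPerm z).symm.arrowCongr (Equiv.refl _)) _ _ fun x => rfl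
  rw [h2]
  refine sum_prod_history_le _ (by positivity) (fun a h ζ => ∑ s, f a h ζ s)
    (fun a h ζ => Finset.sum_nonneg fun s _ => hf0 a h ζ s) fun a h => ?_
  have h3 : ∀ ζ, ∑ s, f a h ζ s ≤ c * (4 * (113 / 100 * ((S.povm a h ζ).trace.re / 2 + δ))) := by
    intro ζ
    refine le_trans ?_ (mul_le_mul_of_nonneg_left
      (sum_bornProb_rpow_le (S.povm_posSemidef a h ζ) hδ) hc0.le)
    rw [Finset.mul_sum]
    refine Finset.sum_le_sum fun s _ => ?_
    have hd := div_pos (hb a h ζ s) (ht a h ζ)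
    -- A crude bound, harmless because `c` is close to `1` when `δ` is small.
    have hcr : c ^ (1 / 3 : ℝ) ≤ c := Real.rpow_le_self_of_one_le hc1 (by norm_num)
    calc f a h ζ s = c ^ (1 / 3 : ℝ) * ((bornProb (S.povm a h ζ) s + δ) *
          ((bornProb (S.povm a h ζ) s + δ) / ((S.povm a h ζ).trace.re / 2 + δ)) ^ (1 / 3 : ℝ)) := by
          rw [hf]
          simp only
          rw [div_div_eq_mul_div, mul_div_right_comm, Real.mul_rpow hd.le hc0.le]
          ring
      _ ≤ _ := mul_le_mul_of_nonneg_right hcr (mul_nonneg (hb a h ζ s).le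
          (Real.rpow_nonneg hd.le _))
  refine (Finset.sum_le_sum fun ζ _ => h3 ζ).trans (le_of_eq ?_)
  simp only [← Finset.mul_sum]
  rw [Finset.sum_add_distrib, ← Finset.sum_div, S.sum_trace]
  simp only [Finset.sum_const, Finset.card_univ, Fintype.card_fin, nsmul_eq_mul]
  rw [div_self (two_ne_zero' ℝ), ← hc]
  ring

/-! ## Discretized strategies -/

/-- The qubit choices together with the outcome probabilities rounded down to multiples of `1/K`. -/
noncomputable def code (K : ℕ) (S : OnePassLOCC n q) :
    (a : Fin n) → (Fin (a : ℕ) → Fin q) → Fin n × (Fin q → Bool × Bool → Fin (K + 1)) :=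
  fun a h => (S.qubit a h, fun ζ s => Fin.ofNat (K + 1) ⌊K * bornProb (S.povm a h ζ) s⌋₊)

lemma bornProb_le_one (S : OnePassLOCC n q) (a : Fin n) (h : Fin (a : ℕ) → Fin q) (ζ : Fin q)
    (s : Bool × Bool) : bornProb (S.povm a h ζ) s ≤ 1 := by
  rw [← S.sum_bornProb a h s]
  exact Finset.single_le_sum (f := fun ζ => bornProb (S.povm a h ζ) s)
    (fun ζ _ => bornProb_nonneg (S.povm_posSemidef _ _ _) _) (Finset.mem_univ ζ)

lemma bornProb_le_of_code_eq {K : ℕ} (hK : 0 < K) {S T : OnePassLOCC n q}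
    (h : S.code K = T.code K) (a : Fin n) (g : Fin (a : ℕ) → Fin q) (ζ : Fin q) (s : Bool × Bool) :
    bornProb (S.povm a g ζ) s ≤ bornProb (T.povm a g ζ) s + 1 / K := by
  have hK' : (0 : ℝ) < K := by exact_mod_cast hK
  have h1 := congrArg (fun f => ((f a g).2 ζ s : ℕ)) h
  -- Probabilities are at most `1`, so the reduction modulo `K + 1` in `Fin.ofNat` never wraps
  -- around.
  have hfl : ∀ R : OnePassLOCC n q, ⌊K * bornProb (R.povm a g ζ) s⌋₊ < K + 1 := by
    intro R
    rw [Nat.lt_succ_iff]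
    refine Nat.floor_le_of_le ?_
    exact mul_le_of_le_one_right hK'.le (R.bornProb_le_one a g ζ s)
  simp only [code, Fin.val_ofNat, Nat.mod_eq_of_lt (hfl _)] at h1
  have h2 := Nat.lt_floor_add_one (K * bornProb (S.povm a g ζ) s)
  have h3 := Nat.floor_le (mul_nonneg hK'.le (bornProb_nonneg (T.povm_posSemidef a g ζ) s))
  rw [h1] at h2
  have : K * bornProb (S.povm a g ζ) s ≤ K * (bornProb (T.povm a g ζ) s + 1 / K) := by
    rw [mul_add, mul_one_div_cancel hK'.ne']
    linarith
  exact le_of_mul_le_mul_left this hK'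

lemma outcomeProb_le_smoothProb {K : ℕ} (hK : 0 < K) {S T : OnePassLOCC n q}
    (h : S.code K = T.code K) (w : Fin n → Bool × Bool) (z : Fin n → Fin q) :
    S.outcomeProb (productState w) z ≤ T.smoothProb (1 / K) w z := by
  rw [outcomeProb_productState]
  refine Finset.prod_le_prod (fun a _ => bornProb_nonneg (S.povm_posSemidef _ _ _) _) fun a _ => ?_
  have hq : S.qubit a (history z a) = T.qubit a (history z a) :=
    congrArg (fun f => (f a (history z a)).1) h
  rw [hq]
  exact bornProb_le_of_code_eq hK h _ _ _ _

/-- The right-hand side depends only on the representative `T`, so a single random event controls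
every strategy in the class. The average of logarithms is written as the logarithm of a product to
suit Markov's inequality. -/
lemma extractedInfo_le_of_code_eq {K m : ℕ} (hK : 0 < K) {S T : OnePassLOCC n q}
    (h : S.code K = T.code K) (E : (Fin m → Bool) → (Fin n → Bool × Bool)) :
    0 < ∏ v, T.smoothMoment (1 / K) (E v) ∧
    extractedInfo E S ≤
      ((2 : ℝ) ^ m)⁻¹ * (3 * Real.logb 2 (∏ v, T.smoothMoment (1 / K) (E v))) := by
  have hδ : (0 : ℝ) < 1 / K := by positivity
  set p : (Fin m → Bool) → (Fin n → Fin q) → ℝ := fun v z =>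
    S.outcomeProb (productState (E v)) z with hpdef
  have hp : ∀ v z, 0 ≤ p v z := fun v z => S.outcomeProb_nonneg _ z
  have hp1 : ∀ v, ∑ z, p v z = 1 := fun v => S.sum_outcomeProb _
  have hq := T.smoothRef_pos hδ
  have hmono : ∀ v, ∑ z, p v z * (p v z / T.smoothRef (1 / K) z) ^ (1 / 3 : ℝ) ≤
      T.smoothMoment (1 / K) (E v) := by
    intro v
    refine Finset.sum_le_sum fun z _ => ?_
    have hle := outcomeProb_le_smoothProb hK h (E v) z
    exact mul_le_mul hle (Real.rpow_le_rpow (div_nonneg (hp v z) (hq z).le)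
      (div_le_div_of_nonneg_right hle (hq z).le) (by norm_num))
      (Real.rpow_nonneg (div_nonneg (hp v z) (hq z).le) _) (T.smoothProb_pos hδ _ _).le
  have hpos : ∀ v, 0 < T.smoothMoment (1 / K) (E v) := fun v =>
    (divergence_le_renyi (p v) _ (hp v) (hp1 v) hq).1.trans_le (hmono v)
  refine ⟨Finset.prod_pos fun v _ => hpos v, ?_⟩
  have hI := mutualInfo_le_avg_divergence p hp hp1 _ hq (T.sum_smoothRef hδ).le
  have hcard : (Fintype.card (Fin m → Bool) : ℝ) = 2 ^ m := by simp
  rw [hcard] at hI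
  have hE : extractedInfo E S = mutualInfo (fun x : (Fin n → Fin q) × (Fin m → Bool) =>
      ((2 : ℝ) ^ m)⁻¹ * p x.2 x.1) := by
    unfold extractedInfo jointDist
    rw [hcard]
  rw [hE]
  refine hI.trans (mul_le_mul_of_nonneg_left ?_ (by positivity))
  rw [Real.logb_prod _ _ fun v _ => (hpos v).ne', Finset.mul_sum]
  refine Finset.sum_le_sum fun v _ => ?_
  obtain ⟨h0, h1⟩ := divergence_le_renyi (p v) _ (hp v) (hp1 v) hq
  exact h1.trans (mul_le_mul_of_nonneg_left
    (Real.logb_le_logb_of_le one_lt_two h0 (hmono v)) (by norm_num))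

/-- The reference law is uniform on the `2^n` outcome strings, against which every likelihood ratio
is at most `2^n`. -/
lemma extractedInfo_le {m : ℕ} (E : (Fin m → Bool) → (Fin n → Bool × Bool))
    (S : OnePassLOCC n 2) : extractedInfo E S ≤ n := by
  have hp : ∀ v z, 0 ≤ S.outcomeProb (productState (E v)) z := fun v z => S.outcomeProb_nonneg _ z
  have hp1 : ∀ v, ∑ z, S.outcomeProb (productState (E v)) z = 1 := fun v => S.sum_outcomeProb _
  refine (mutualInfo_le_avg_divergence (fun v => S.outcomeProb (productState (E v))) hp hp1
    (fun _ => ((2 : ℝ) ^ n)⁻¹) (fun _ => by positivity) (by simp)).trans ?_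
  rw [inv_mul_le_iff₀ (by exact_mod_cast Fintype.card_pos)]
  have : ∀ v, ∑ z, S.outcomeProb (productState (E v)) z *
      Real.logb 2 (S.outcomeProb (productState (E v)) z / ((2 : ℝ) ^ n)⁻¹) ≤ n := by
    intro v
    calc _ ≤ ∑ z, S.outcomeProb (productState (E v)) z * (n : ℝ) := by
          refine Finset.sum_le_sum fun z _ => ?_
          rcases (hp v z).eq_or_lt with h | h
          · simp [← h]
          · refine mul_le_mul_of_nonneg_left ?_ h.le
            have hle : S.outcomeProb (productState (E v)) z ≤ 1 := by
              rw [← hp1 v]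
              exact Finset.single_le_sum (fun z _ => hp v z) (Finset.mem_univ z)
            rw [div_inv_eq_mul, Real.logb_le_iff_le_rpow one_lt_two (by positivity),
              Real.rpow_natCast]
            exact mul_le_of_le_one_left (by positivity) hle
      _ = n := by rw [← Finset.sum_mul, hp1, one_mul]
  refine (Finset.sum_le_sum fun v _ => this v).trans (le_of_eq ?_)
  simp

end OnePassLOCC

/-! ## Random encodings -/

instance isProbabilityMeasure_uniformOn_univ_words (n : ℕ) : MeasureTheory.IsProbabilityMeasure
    (ProbabilityTheory.uniformOn (Set.univ : Set (Fin n → Bool × Bool))) :=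
  ProbabilityTheory.isProbabilityMeasure_uniformOn Set.finite_univ Set.univ_nonempty

instance isProbabilityMeasure_encodingLaw (m n : ℕ) :
    MeasureTheory.IsProbabilityMeasure (encodingLaw m n) := by
  unfold encodingLaw
  infer_instance

/-- Markov's inequality for a product of independent nonnegative functions of the codewords. -/
lemma encodingLaw_markov (m n : ℕ) (f : (Fin n → Bool × Bool) → ℝ) (hf : ∀ w, 0 ≤ f w) {B t : ℝ}
    (ht : 0 < t) (hB : ∑ w, f w ≤ (4 * B) ^ n) :
    (encodingLaw m n).real {E | (t ^ n) ^ 2 ^ m ≤ ∏ v, f (E v)} ≤ ((B / t) ^ n) ^ 2 ^ m := by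
  have hint : ∫ w, f w ∂(ProbabilityTheory.uniformOn Set.univ) ≤ B ^ n := by
    rw [MeasureTheory.integral_fintype (MeasureTheory.Integrable.of_finite)]
    have : ∀ w : Fin n → Bool × Bool,
        (ProbabilityTheory.uniformOn Set.univ).real {w} = ((4 : ℝ) ^ n)⁻¹ := by
      intro w
      rw [MeasureTheory.measureReal_def, ProbabilityTheory.uniformOn_univ]
      simp
    simp only [this, smul_eq_mul, ← Finset.mul_sum]
    rw [inv_mul_le_iff₀ (by positivity), ← mul_pow]
    exact hB
  have h := MeasureTheory.mul_meas_ge_le_integral_of_nonneg (μ := encodingLaw m n)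
    (f := fun E => ∏ v, f (E v))
    (Filter.Eventually.of_forall fun E => Finset.prod_nonneg fun v _ => hf _)
    MeasureTheory.Integrable.of_finite ((t ^ n) ^ 2 ^ m)
  have h2 : ∫ E, ∏ v, f (E v) ∂(encodingLaw m n) =
      (∫ w, f w ∂(ProbabilityTheory.uniformOn Set.univ)) ^ 2 ^ m := by
    unfold encodingLaw
    rw [MeasureTheory.integral_fintype_prod_eq_prod (fun _ => f)]
    simp
  rw [h2] at h
  have h3 := h.trans (pow_le_pow_left₀ (MeasureTheory.integral_nonneg hf) hint _)
  rw [div_pow, div_pow, le_div_iff₀' (by positivity)]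
  exact h3

/-! ### Union bound over discretized strategies -/

lemma sum_fin_two_pow_lt (n : ℕ) : ∑ a : Fin n, 2 ^ (a : ℕ) < 2 ^ n := by
  rw [Fin.sum_univ_eq_sum_range (fun a => 2 ^ a)]
  exact Nat.geomSum_lt le_rfl fun k hk => Finset.mem_range.1 hk

/-- Each history carries a qubit and `2 * 4 = 8` rounded probabilities, and there are fewer than
`2^n` histories. -/
lemma card_code_le (n K : ℕ) (hn : 1 ≤ n) :
    Fintype.card ((a : Fin n) → (Fin (a : ℕ) → Fin 2) →
      Fin n × (Fin 2 → Bool × Bool → Fin (K + 1))) ≤ (n * (K + 1) ^ 8) ^ 2 ^ n := by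
  have : ∀ a : Fin n, Fintype.card ((Fin (a : ℕ) → Fin 2) →
      Fin n × (Fin 2 → Bool × Bool → Fin (K + 1))) = (n * (K + 1) ^ 8) ^ 2 ^ (a : ℕ) := by
    intro a
    simp [← pow_mul]
  rw [Fintype.card_pi]
  simp only [this]
  rw [Finset.prod_pow_eq_pow_sum]
  exact Nat.pow_le_pow_right (by positivity) (sum_fin_two_pow_lt n).le

/-- The single-qubit moment bound with smoothing parameter `10⁻⁴`, relative to `2^{0.54/3}`. -/
noncomputable def rate : ℝ := 113 / 100 * (1 + (2 : ℕ) * (1 / (10000 : ℕ))) ^ 2 / 2 ^ (9 / 50 : ℝ)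

lemma rate_pos : 0 < rate := by unfold rate; positivity

lemma rate_lt_one : rate < 1 := by
  unfold rate
  rw [div_lt_one (by positivity)]
  -- The 50th power turns `2^(9/50)` into `2^9`, leaving a rational inequality.
  refine lt_of_pow_lt_pow_left₀ 50 (by positivity) ?_
  rw [← Real.rpow_natCast (2 ^ (9 / 50 : ℝ)), ← Real.rpow_mul (by norm_num)]
  norm_num

lemma encodingLaw_code_le (m n : ℕ) (c : (a : Fin n) → (Fin (a : ℕ) → Fin 2) →
      Fin n × (Fin 2 → Bool × Bool → Fin (10000 + 1))) :
    (encodingLaw m n).real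
      {E | ∃ S : OnePassLOCC n 2, S.code 10000 = c ∧ 0.54 * (n : ℝ) < extractedInfo E S} ≤
      (rate ^ n) ^ 2 ^ m := by
  by_cases hc : ∃ T : OnePassLOCC n 2, T.code 10000 = c
  · obtain ⟨T, rfl⟩ := hc
    have hδ : (0 : ℝ) < 1 / (10000 : ℕ) := by norm_num
    refine (MeasureTheory.measureReal_mono ?_).trans
      (encodingLaw_markov m n (T.smoothMoment (1 / (10000 : ℕ))) (T.smoothMoment_nonneg hδ)
      (t := 2 ^ (9 / 50 : ℝ)) (by positivity) (T.sum_smoothMoment_le hδ))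
    rintro E ⟨S, hS, hlt⟩
    obtain ⟨hpos, hle⟩ := OnePassLOCC.extractedInfo_le_of_code_eq (by norm_num) hS E
    have h := hlt.trans_le hle
    rw [← div_eq_inv_mul, lt_div_iff₀ (by positivity)] at h
    have h' : 9 / 50 * (n : ℝ) * 2 ^ m ≤
        Real.logb 2 (∏ v, T.smoothMoment (1 / (10000 : ℕ)) (E v)) := by
      norm_num at h ⊢
      linarith
    rw [Real.le_logb_iff_rpow_le one_lt_two hpos] at h'
    refine le_trans (le_of_eq ?_) h'
    rw [← pow_mul, ← Real.rpow_natCast, ← Real.rpow_mul two_pos.le]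
    push_cast
    rw [mul_assoc]
  · have : {E : (Fin m → Bool) → (Fin n → Bool × Bool) | ∃ S : OnePassLOCC n 2,
        S.code 10000 = c ∧ 0.54 * (n : ℝ) < extractedInfo E S} = ∅ :=
      Set.eq_empty_of_forall_notMem fun E ⟨S, hS, _⟩ => hc ⟨S, hS⟩
    rw [this, MeasureTheory.measureReal_empty]
    exact pow_nonneg (pow_nonneg rate_pos.le _) _

lemma encodingLaw_exists_le (m n : ℕ) (hn : 1 ≤ n) :
    (encodingLaw m n).real
      {E | ∃ S : OnePassLOCC n 2, 0.54 * (n : ℝ) < extractedInfo E S} ≤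
      ((n : ℝ) * 10001 ^ 8) ^ 2 ^ n * (rate ^ n) ^ 2 ^ m := by
  have hU : {E : (Fin m → Bool) → (Fin n → Bool × Bool) | ∃ S : OnePassLOCC n 2,
      0.54 * (n : ℝ) < extractedInfo E S} = ⋃ c, {E | ∃ S : OnePassLOCC n 2,
        S.code 10000 = c ∧ 0.54 * (n : ℝ) < extractedInfo E S} := by
    ext E
    simp
  rw [hU]
  refine (MeasureTheory.measureReal_iUnion_fintype_le _).trans ?_
  refine (Finset.sum_le_sum fun c _ => encodingLaw_code_le m n c).trans ?_
  rw [Finset.sum_const, Finset.card_univ, nsmul_eq_mul]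
  refine mul_le_mul_of_nonneg_right ?_ (pow_nonneg (pow_nonneg rate_pos.le _) _)
  have := card_code_le n 10000 hn
  have h' : ((Fintype.card ((a : Fin n) → (Fin (a : ℕ) → Fin 2) →
      Fin n × (Fin 2 → Bool × Bool → Fin (10000 + 1))) : ℕ) : ℝ) ≤
      (((n * (10000 + 1) ^ 8) ^ 2 ^ n : ℕ) : ℝ) := by exact_mod_cast this
  refine h'.trans (le_of_eq ?_)
  push_cast
  norm_num

/-- With `2^n ≤ 2^c * 2^m`, everything sits under one exponent `2^m`, over the base `n^(2^c) *
rate^n * const`. The exponential decay makes this base less than `1/2` for large `n`, while `2^m ≥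
n^2`. -/
lemma eventually_union_bound_le (c : ℕ) : ∃ n₀ : ℕ, 2 ≤ n₀ ∧ ∀ n m : ℕ, n₀ ≤ n → n ≤ m + c →
    ((n : ℝ) * 10001 ^ 8) ^ 2 ^ n * (rate ^ n) ^ 2 ^ m ≤ (1 / 2) ^ n ^ 2 := by
  have h1 := (tendsto_pow_const_mul_const_pow_of_abs_lt_one (2 ^ c)
    (by rw [abs_of_pos rate_pos]; exact rate_lt_one)).mul_const (((10001 : ℝ) ^ 8) ^ 2 ^ c)
  rw [zero_mul] at h1
  have h2 := tendsto_pow_const_mul_const_pow_of_abs_lt_one 2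
    (show |(1 / 2 : ℝ)| < 1 by rw [abs_of_pos] <;> norm_num)
  have e1 := h1.eventually_lt_const (show (0 : ℝ) < 1 / 2 by norm_num)
  have e2 := h2.eventually_lt_const (show (0 : ℝ) < 1 / 2 ^ c by positivity)
  obtain ⟨n₁, hn₁⟩ := Filter.eventually_atTop.1 (e1.and e2)
  refine ⟨max n₁ 2, le_max_right _ _, fun n m hn hnm => ?_⟩
  obtain ⟨a1, a2⟩ := hn₁ n ((le_max_left _ _).trans hn)
  have hn1 : (1 : ℝ) ≤ n := by
    have : 1 ≤ n := by have := (le_max_right n₁ 2).trans hn; omega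
    exact_mod_cast this
  have hpow : 2 ^ n ≤ 2 ^ c * 2 ^ m := by
    rw [← pow_add]
    exact Nat.pow_le_pow_right two_pos (by omega)
  have hsq : n ^ 2 ≤ 2 ^ m := by
    have h3 : (n : ℝ) ^ 2 * 2 ^ c < 2 ^ n := by
      rw [one_div, inv_pow, ← div_eq_mul_inv, div_lt_div_iff₀ (by positivity) (by positivity)] at a2
      linarith
    have h4 : n ^ 2 * 2 ^ c < 2 ^ n := by exact_mod_cast h3
    have h5 : n ^ 2 * 2 ^ c ≤ 2 ^ m * 2 ^ c := by linarith
    exact Nat.le_of_mul_le_mul_right h5 (by positivity)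
  have hr := rate_pos
  calc ((n : ℝ) * 10001 ^ 8) ^ 2 ^ n * (rate ^ n) ^ 2 ^ m
      ≤ ((n : ℝ) * 10001 ^ 8) ^ (2 ^ c * 2 ^ m) * (rate ^ n) ^ 2 ^ m := by
        refine mul_le_mul_of_nonneg_right (pow_le_pow_right₀ ?_ hpow) (by positivity)
        exact one_le_mul_of_one_le_of_one_le hn1 (one_le_pow₀ (by norm_num))
    _ = ((n : ℝ) ^ 2 ^ c * rate ^ n * (10001 ^ 8) ^ 2 ^ c) ^ 2 ^ m := by
        rw [pow_mul, ← mul_pow, mul_pow (n : ℝ)]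
        congr 1
        ring
    _ ≤ (1 / 2) ^ 2 ^ m := pow_le_pow_left₀ (by positivity) a1.le _
    _ ≤ (1 / 2) ^ n ^ 2 := pow_le_pow_of_le_one (by norm_num) (by norm_num) hsq

/-! ### The theorem -/

theorem mainTheorem2 :
    ∃ C₂ : ℝ, ∀ c : ℕ, ∃ C₁ : ℝ,
      ∀ n n' : ℕ, 1 ≤ n → n' ≤ n → n ≤ n' + c →
        ∀ t₀ u : ℝ, 0 < t₀ → 1 ≤ u →
          1 - Real.exp (-2 * t₀ ^ 2) - 2 * (2 : ℝ) ^ (-(u ^ 2)) ≤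
            (encodingLaw n' n).real
              {E | ∀ S : OnePassLOCC n 2,
                extractedInfo E S ≤
                  0.54 * (n : ℝ) + C₁ + t₀ * (n' : ℝ) * (2 : ℝ) ^ (-((n' : ℝ) / 2))
                    + u * (C₂ * √(Real.log (n : ℝ)))} := by
  -- `C₂ = 2` gives `C₂ √(log n) ≥ 1` for all `n ≥ 2`, so the deviation term is at least `u`.
  refine ⟨2, fun c => ?_⟩
  obtain ⟨n₀, hn₀, hbound⟩ := eventually_union_bound_le c
  refine ⟨n₀, fun n m hn _ hnm t u ht hu => ?_⟩
  set G : Set ((Fin m → Bool) → (Fin n → Bool × Bool)) := {E | ∀ S : OnePassLOCC n 2,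
    extractedInfo E S ≤ 0.54 * (n : ℝ) + n₀ + t * (m : ℝ) * (2 : ℝ) ^ (-((m : ℝ) / 2))
      + u * (2 * √(Real.log (n : ℝ)))} with hG
  have hexp := Real.exp_pos (-2 * t ^ 2)
  have htwo : (0 : ℝ) < 2 ^ (-(u ^ 2)) := by positivity
  have hslack : 0 ≤ t * (m : ℝ) * (2 : ℝ) ^ (-((m : ℝ) / 2)) := by positivity
  have hdev : 0 ≤ u * (2 * √(Real.log (n : ℝ))) := by positivity
  have hn0 : (0 : ℝ) ≤ n := n.cast_nonneg
  have hn₀0 : (0 : ℝ) ≤ n₀ := n₀.cast_nonneg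
  have htrivial : (n : ℝ) ≤ n₀ ∨ (n : ℝ) ≤ u * (2 * √(Real.log (n : ℝ))) →
      1 - Real.exp (-2 * t ^ 2) - 2 * (2 : ℝ) ^ (-(u ^ 2)) ≤ (encodingLaw m n).real G := by
    intro h
    have : G = Set.univ := by
      refine Set.eq_univ_of_forall fun E S => (OnePassLOCC.extractedInfo_le E S).trans ?_
      rcases h with h | h <;> norm_num <;> linarith
    rw [this, MeasureTheory.probReal_univ]
    linarith
  by_cases hsmall : n < n₀
  · exact htrivial (Or.inl (by exact_mod_cast hsmall.le))
  push Not at hsmall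
  -- If `u > n`, the deviation term alone exceeds the trivial bound `n`. Otherwise the failure
  -- probability `2^(-n^2)` is at most `2^(-u^2)`.
  by_cases hlarge : (n : ℝ) < u
  · refine htrivial (Or.inr (hlarge.le.trans (le_mul_of_one_le_right (by linarith) ?_)))
    have hn2 : (2 : ℝ) ≤ n := by exact_mod_cast hn₀.trans hsmall
    have hlog : (1 / 2) ^ 2 ≤ Real.log n := by
      have := Real.log_two_gt_d9
      have := Real.log_le_log two_pos hn2
      norm_num
      linarith
    have := Real.le_sqrt_of_sq_le hlog
    linarith
  push Not at hlarge
  have hbad := (encodingLaw_exists_le m n hn).trans (hbound n m hsmall hnm)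
  have hcompl : Gᶜ ⊆ {E | ∃ S : OnePassLOCC n 2, 0.54 * (n : ℝ) < extractedInfo E S} := by
    intro E hE
    rw [hG, Set.mem_compl_iff, Set.mem_ofPred_eq] at hE
    push Not at hE
    obtain ⟨S, hS⟩ := hE
    exact ⟨S, by linarith⟩
  have hGc := (MeasureTheory.measureReal_mono (μ := encodingLaw m n) hcompl).trans hbad
  rw [MeasureTheory.probReal_compl_eq_one_sub (Set.toFinite G).measurableSet] at hGc
  have hpow : ((1 : ℝ) / 2) ^ n ^ 2 ≤ 2 ^ (-(u ^ 2)) := by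
    rw [one_div, inv_pow, ← Real.rpow_natCast, ← Real.rpow_neg two_pos.le]
    refine Real.rpow_le_rpow_of_exponent_le one_lt_two.le (neg_le_neg ?_)
    push_cast
    exact pow_le_pow_left₀ (by linarith) hlarge 2
  linarith
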